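/- For integers $a,n\ge 0$ let $MO(a;n)$ denote the sum of the products $s_1s_2\cdots s_a$ over all partitions $n=s_1k_1+s_2k_2+\cdots+s_ak_a$ of $n$ with exactly $a$ different part sizes $0<k_1<k_2<\cdots<k_a$, where the part $k_i$ occurs with multiplicity $s_i\ge 1$; equivalently, $$\sum_{n\ge 0}MO(a;n)q^n=\sum_{0<k_1<k_2<\cdots<k_a}\frac{q^{k_1+k_2+\cdots+k_a}}{(1-q^{k_1})^2(1-q^{k_2})^2\cdots(1-q^{k_a})^2}.$$ Then the following are true for every pair of non-negative integers $m$ and $n$. (i) $MO(3m+2;3n+1)\equiv MO(3m+2;3n+2)\equiv 0\pmod 3$. (ii) $MO(11m+10;11n+7)\equiv 0\pmod{11}$. (iii) $MO(17m+16;17n+15)\equiv 0\pmod{17}$. -/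

import Mathlib

/-- MacMahon's partition function `MO(a; n)`: the sum, over all partitions of `n` having exactly
`a` different part sizes `k₁ < k₂ < ⋯ < k_a`, of the product `s₁ s₂ ⋯ s_a` of the multiplicities
with which these part sizes occur. -/
def MO (a n : ℕ) : ℕ :=
  ∑ p : n.Partition with p.parts.toFinset.card = a,
    ∏ k ∈ p.parts.toFinset, p.parts.count k

set_option autoImplicit false

/-! ### Level one modular forms: the Serre derivative and identities between Eisenstein series. -/

section

open UpperHalfPlane hiding I
open ModularForm EisensteinSeries Derivative Complex Function MatrixGroups
open scoped Manifold Real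

/-! Let `e = ∏ (1 - q^k)`. Weighting each part size by `y`, the generating function is `∏ (1 + y q^k
/ (1 - q^k)^2)`. For `y = 2 - ζ - ζ⁻¹` the numerator `(1 - q^k)^2 + y q^k` equals `(1 - ζ q^k)(1 -
ζ⁻¹ q^k)`, so the triple product turns `e^3` times the generating function into a theta series over
triangular exponents `n(n+1)/2` (`moGenFun_mul_eulerProd_pow`).

When `a ≡ -1 mod p`, the coefficient of `y^a` in the `n`-th theta coefficient vanishes mod `p`
unless `p` divides `n(n+1)` (`coeff_chebU_eq_zero`). Hence, for odd `p`, `e^3 ∑ MO(a;n) q^n` is a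
series in `q^p` mod `p`. Since `e^p` is one too, `MO(a;·)` vanishes mod `p` on every residue class
on which `e^(p-3)` does (`MO_modEq_zero`).

For `p = 3` this power is `1`. For `p = 11, 17`, put `θ = q d/dq`. A polynomial `G` in `E₄, E₆` of
weight `k` with `2k ≡ 3 mod p` makes the `E₂` terms cancel in `θ(e^(p-3) G)`. It is chosen so that
its Serre derivative is a nonzero constant mod `p`, because `E_(p-1) ≡ 1`. Then `F = e^(p-3) G`
satisfies `θF ≡ F/8 + c e^(p-3)` with `c ≠ 0`, so `e^(p-3)` vanishes at exponents `n ≡ 1/8`, namely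
`7 mod 11` and `15 mod 17`. -/

lemma hasSum_normalizedDeriv {k : ℤ} (f : ModularForm 𝒮ℒ k) (τ : ℍ) :
    HasSum (fun m : ℕ ↦ (m * (qExpansion 1 f).coeff m) • Periodic.qParam 1 τ ^ m) (D f τ) := by
  have hper : Periodic ((f : ℍ → ℂ) ∘ ofComplex) (1 : ℝ) :=
    SlashInvariantFormClass.periodic_comp_ofComplex f one_mem_strictPeriods_SL
  have hhol : MDiff (f : ℍ → ℂ) := f.holo'
  have hbdd : IsBoundedAtImInfty (f : ℍ → ℂ) := ModularFormClass.bdd_at_infty f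
  set g := cuspFunction 1 f with hg
  have hgd : DifferentiableOn ℂ g (Metric.ball 0 1) :=
    differentiableOn_cuspFunction_ball one_pos hper hhol hbdd
  set q := Periodic.qParam 1 (τ : ℂ) with hq
  have hq1 : q ∈ Metric.ball (0 : ℂ) 1 := by
    simpa using Periodic.norm_qParam_lt_one one_pos τ.im_pos
  have htay := Complex.hasSum_taylorSeries_on_ball (hgd.deriv Metric.isOpen_ball) hq1
  -- Chain rule for `f = g ∘ q`, where `dq/dτ = 2πi q`.
  have hval : D f τ = q * deriv g q := by
    have h1 : HasDerivAt (Periodic.qParam 1) (2 * π * I * q) (τ : ℂ) := by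
      have : HasDerivAt (fun z : ℂ ↦ cexp (2 * π * I * z / (1 : ℝ)))
          (cexp (2 * π * I * τ / (1 : ℝ)) * (2 * π * I * 1 / (1 : ℝ))) (τ : ℂ) :=
        (((hasDerivAt_id _).const_mul _).div_const _).cexp
      convert! this using 1
      simp [hq, Periodic.qParam]
      ring
    have h2 : HasDerivAt g (deriv g q) q :=
      ((hgd q hq1).differentiableAt (Metric.isOpen_ball.mem_nhds hq1)).hasDerivAt
    have h3 := h2.comp (τ : ℂ) h1
    have h4 : ((f : ℍ → ℂ) ∘ ofComplex) =ᶠ[nhds (τ : ℂ)] (g ∘ Periodic.qParam 1) := by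
      filter_upwards with z
      exact (Periodic.eq_cuspFunction one_ne_zero hper z).symm
    rw [normalizedDerivOfComplex, h4.deriv_eq, h3.deriv]
    field_simp [Real.pi_ne_zero, I_ne_zero]
  -- The term `m = 0` vanishes; dropping it aligns the series with `q` times the Taylor series of
  -- `g'`.
  rw [hval, ← hasSum_nat_add_iff' 1]
  simp only [Finset.range_one, Finset.sum_singleton, Nat.cast_zero, zero_mul, zero_smul, sub_zero]
  convert! htay.mul_left q using 1
  funext n
  simp only [qExpansion_coeff, sub_zero, smul_eq_mul, ← hg, ← iteratedDeriv_succ',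
    Nat.factorial_succ]
  push_cast
  have : (n.factorial : ℂ) ≠ 0 := by exact_mod_cast n.factorial_ne_zero
  have : (n + 1 : ℂ) ≠ 0 := by exact_mod_cast n.succ_ne_zero
  field_simp
  ring

/-- The Serre derivative of a modular form of level one, as a modular form. -/
noncomputable def serreDerivativeForm {k : ℤ} (f : ModularForm 𝒮ℒ k) : ModularForm 𝒮ℒ (k + 2) where
  toFun := serreDerivative k f
  slash_action_eq' := fun _ ⟨γ, hγ⟩ ↦ hγ ▸ serreDerivative_slash_invariant f.holo'
    (f.slash_action_eq' _ ⟨γ, rfl⟩)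
  holo' := serreDerivative_mdifferentiable _ f.holo'
  bdd_at_cusps' {c} hc := by
    rw [Subgroup.IsArithmetic.isCusp_iff_isCusp_SL2Z] at hc
    rw [OnePoint.isBoundedAt_iff_forall_SL2Z hc]
    intro γ _
    rw [show serreDerivative k f ∣[k + 2] γ = serreDerivative k f from
      serreDerivative_slash_invariant f.holo' (f.slash_action_eq' _ ⟨γ, rfl⟩)]
    have h1 : IsBoundedAtImInfty (D f) :=
      isBoundedAtImInfty_of_hasSum_qExpansion one_pos (hasSum_normalizedDeriv f)
    have h2 : IsBoundedAtImInfty (f : ℍ → ℂ) := ModularFormClass.bdd_at_infty f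
    have h3 : IsBoundedAtImInfty (fun z ↦ (k * 12⁻¹ : ℂ) * (E2 z * f z)) :=
      (isBoundedAtImInfty_E2.mul h2).const_mul_left _
    have h4 : serreDerivative k f = D f - fun z ↦ (k * 12⁻¹ : ℂ) * (E2 z * f z) := by
      ext z
      simp [mul_assoc]
    rw [h4]
    exact h1.sub h3

/-- The Euler operator `q d/dq` on formal power series. -/
noncomputable def PowerSeries.euler (R : Type*) [CommRing R] :
    Derivation R (PowerSeries R) (PowerSeries R) :=
  (PowerSeries.X : PowerSeries R) • PowerSeries.derivative R

lemma PowerSeries.coeff_euler {R : Type*} [CommRing R] (f : PowerSeries R) (n : ℕ) :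
    (PowerSeries.euler R f).coeff n = n * f.coeff n := by
  cases n with
  | zero => simp [euler]
  | succ n =>
    simp [euler, PowerSeries.coeff_succ_X_mul, PowerSeries.coeff_derivative, mul_comm]

lemma periodic_comp_ofComplex_of_hasSum {f : ℍ → ℂ} {c : ℕ → ℂ}
    (hf : ∀ τ : ℍ, HasSum (fun m ↦ c m • Periodic.qParam 1 τ ^ m) (f τ)) :
    Periodic (f ∘ ofComplex) (1 : ℝ) := by
  intro z
  by_cases hz : 0 < z.im
  · have hz' : 0 < (z + (1 : ℝ)).im := by simpa using hz
    simp only [comp_apply, ofComplex_apply_of_im_pos hz, ofComplex_apply_of_im_pos hz']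
    refine (hf _).unique ?_
    convert hf ⟨z, hz⟩ using 4
    simp [Periodic.qParam, mul_add, Complex.exp_add]
  · have hz' : ¬ 0 < (z + (1 : ℝ)).im := by simpa using hz
    simp only [comp_apply]
    rw [ofComplex_apply_of_im_nonpos (not_lt.mp hz), ofComplex_apply_of_im_nonpos (not_lt.mp hz')]

lemma analyticAt_cuspFunction_of_hasSum {f : ℍ → ℂ} (hhol : MDiff f) {c : ℕ → ℂ}
    (hf : ∀ τ : ℍ, HasSum (fun m ↦ c m • Periodic.qParam 1 τ ^ m) (f τ)) :
    AnalyticAt ℂ (cuspFunction 1 f) 0 :=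
  analyticAt_cuspFunction_zero one_pos (periodic_comp_ofComplex_of_hasSum hf) hhol
    (isBoundedAtImInfty_of_hasSum_qExpansion one_pos hf)

lemma coeff_qExpansion_of_hasSum {f : ℍ → ℂ} (hhol : MDiff f) {c : ℕ → ℂ}
    (hf : ∀ τ : ℍ, HasSum (fun m ↦ c m • Periodic.qParam 1 τ ^ m) (f τ)) (m : ℕ) :
    (qExpansion 1 f).coeff m = c m := by
  have hana := analyticAt_cuspFunction_of_hasSum hhol hf
  have h := (hasFPowerSeriesOnBall_cuspFunction one_pos hana hf).hasFPowerSeriesAt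
  have := congr_arg (FormalMultilinearSeries.coeff · m)
    (hana.hasFPowerSeriesAt.eq_formalMultilinearSeries h)
  simpa [qExpansion_coeff, div_eq_inv_mul] using this

lemma analyticAt_cuspFunction_normalizedDeriv {k : ℤ} (f : ModularForm 𝒮ℒ k) :
    AnalyticAt ℂ (cuspFunction 1 (D f)) 0 :=
  analyticAt_cuspFunction_of_hasSum (normalizedDerivOfComplex_mdifferentiable f.holo')
    (hasSum_normalizedDeriv f)

lemma hasSum_qParam_E2 (τ : ℍ) :
    HasSum (fun m : ℕ ↦ (if m = 0 then 1 else -24 * (ArithmeticFunction.sigma 1 m : ℂ)) •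
      Periodic.qParam 1 τ ^ m) (E2 τ) := by
  simpa only [Periodic.qParam, ofReal_one, div_one] using hasSum_qExpansion_E2 (z := τ)

lemma analyticAt_cuspFunction_E2 : AnalyticAt ℂ (cuspFunction 1 E2) 0 :=
  analyticAt_cuspFunction_of_hasSum E2_mdifferentiable hasSum_qParam_E2

lemma coeff_qExpansion_E2 (m : ℕ) : (qExpansion 1 E2).coeff m =
    if m = 0 then 1 else -24 * (ArithmeticFunction.sigma 1 m : ℂ) :=
  coeff_qExpansion_of_hasSum E2_mdifferentiable hasSum_qParam_E2 m

lemma qExpansion_serreDerivativeForm {k : ℤ} (f : ModularForm 𝒮ℒ k) :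
    qExpansion 1 (serreDerivativeForm f) = PowerSeries.euler ℂ (qExpansion 1 f) -
      (k * 12⁻¹ : ℂ) • (qExpansion 1 E2 * qExpansion 1 f) := by
  have hf := ModularFormClass.analyticAt_cuspFunction_zero f one_pos one_mem_strictPeriods_SL
  have h1 : qExpansion 1 (D f) = PowerSeries.euler ℂ (qExpansion 1 f) := by
    ext m
    rw [PowerSeries.coeff_euler]
    exact coeff_qExpansion_of_hasSum (normalizedDerivOfComplex_mdifferentiable f.holo')
      (hasSum_normalizedDeriv f) m
  have hE := analyticAt_cuspFunction_E2
  have hmul : AnalyticAt ℂ (cuspFunction 1 (E2 * f)) 0 := by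
    rw [cuspFunction_mul hE.continuousAt hf.continuousAt]
    exact hE.mul hf
  have hsmul : AnalyticAt ℂ (cuspFunction 1 ((k * 12⁻¹ : ℂ) • (E2 * f))) 0 := by
    rw [cuspFunction_smul hmul.continuousAt]
    exact analyticAt_const.smul hmul
  have hfun : (serreDerivativeForm f : ℍ → ℂ) = D f - (k * 12⁻¹ : ℂ) • (E2 * f) := by
    ext z
    change serreDerivative k f z = _
    simp [mul_assoc]
  rw [hfun, qExpansion_sub (analyticAt_cuspFunction_normalizedDeriv f) hsmul,
    qExpansion_smul hmul, qExpansion_mul hE hf, h1]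

/-- Two level one forms of weight less than twelve with the same constant term agree. -/
lemma eq_of_constantCoeff_eq {k : ℤ} (hk : k.toNat < 12) {f g : ModularForm 𝒮ℒ k}
    (h : (qExpansion 1 f).coeff 0 = (qExpansion 1 g).coeff 0) : f = g := by
  rw [← sub_eq_zero]
  refine sturm_bound_levelOne ?_
  rw [Nat.div_eq_of_lt hk, Nat.cast_zero, pos_iff_ne_zero,
    PowerSeries.order_ne_zero_iff_constCoeff_eq_zero,
    FunLike.coe_sub, ModularForm.qExpansion_sub one_pos one_mem_strictPeriods_SL, map_sub]
  simpa [sub_eq_zero] using h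

/-- The power series `∑ σ_k(n) q^n`. -/
noncomputable def sigmaSeries (R : Type*) [CommRing R] (k : ℕ) : PowerSeries R :=
  PowerSeries.mk fun n ↦ (ArithmeticFunction.sigma k n : R)

lemma qExpansion_E2_eq : qExpansion 1 E2 = 1 - 24 * sigmaSeries ℂ 1 := by
  ext m
  have h24 : (24 : PowerSeries ℂ) = PowerSeries.C 24 := (map_ofNat _ _).symm
  rw [coeff_qExpansion_E2, map_sub, h24, PowerSeries.coeff_C_mul, PowerSeries.coeff_one,
    sigmaSeries, PowerSeries.coeff_mk]
  split_ifs with h <;> simp [h]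

lemma qExpansion_E_eq {k : ℕ} (hk : 3 ≤ k) (hk2 : Even k) {c : ℂ}
    (hc : c = -(2 * k / bernoulli k)) :
    qExpansion 1 (E hk) = 1 + PowerSeries.C c * sigmaSeries ℂ (k - 1) := by
  ext m
  rw [E_qExpansion_coeff hk hk2, map_add, PowerSeries.coeff_C_mul, PowerSeries.coeff_one,
    sigmaSeries, PowerSeries.coeff_mk, hc]
  split_ifs with h <;> simp [h]

lemma qExpansion_E4_eq : qExpansion 1 E₄ = 1 + 240 * sigmaSeries ℂ 3 := by
  rw [qExpansion_E_eq (c := 240) _ ⟨2, rfl⟩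
    (by norm_num [show bernoulli 4 = -1 / 30 by decide +kernel]), map_ofNat]

lemma qExpansion_E6_eq : qExpansion 1 E₆ = 1 - 504 * sigmaSeries ℂ 5 := by
  rw [qExpansion_E_eq (c := -504) _ ⟨3, rfl⟩
    (by norm_num [show bernoulli 6 = 1 / 42 by decide +kernel]), map_neg, map_ofNat,
    neg_mul, sub_eq_add_neg]

lemma qExpansion_E10_eq :
    qExpansion 1 (E (k := 10) (by norm_num)) = 1 - 264 * sigmaSeries ℂ 9 := by
  rw [qExpansion_E_eq (c := -264) _ ⟨5, rfl⟩
    (by norm_num [show bernoulli 10 = 5 / 66 by decide +kernel]), map_neg, map_ofNat,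
    neg_mul, sub_eq_add_neg]

lemma bernoulli_sixteen : bernoulli 16 = -3617 / 510 := by
  have h3 : bernoulli 3 = 0 := bernoulli_eq_zero_of_odd (by decide) (by norm_num)
  have h5 : bernoulli 5 = 0 := bernoulli_eq_zero_of_odd (by decide) (by norm_num)
  have h7 : bernoulli 7 = 0 := bernoulli_eq_zero_of_odd (by decide) (by norm_num)
  have h9 : bernoulli 9 = 0 := bernoulli_eq_zero_of_odd (by decide) (by norm_num)
  have h11 : bernoulli 11 = 0 := bernoulli_eq_zero_of_odd (by decide) (by norm_num)
  have h13 : bernoulli 13 = 0 := bernoulli_eq_zero_of_odd (by decide) (by norm_num)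
  have h15 : bernoulli 15 = 0 := bernoulli_eq_zero_of_odd (by decide) (by norm_num)
  -- With the odd Bernoulli numbers gone, these recurrences form a triangular linear system for `B₂,
  -- …, B₁₆`.
  have h2 := sum_bernoulli 3
  have h4 := sum_bernoulli 5
  have h6 := sum_bernoulli 7
  have h8 := sum_bernoulli 9
  have h10 := sum_bernoulli 11
  have h12 := sum_bernoulli 13
  have h14 := sum_bernoulli 15
  have h16 := sum_bernoulli 17
  norm_num [Finset.sum_range_succ, Nat.choose, h3, h5, h7, h9, h11, h13, h15]
    at h2 h4 h6 h8 h10 h12 h14 h16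
  linarith

lemma qExpansion_E16_eq :
    3617 * qExpansion 1 (E (k := 16) (by norm_num)) = 3617 + 16320 * sigmaSeries ℂ 15 := by
  rw [qExpansion_E_eq (c := 16320 / 3617) _ ⟨8, rfl⟩
    (by norm_num [bernoulli_sixteen])]
  have h : (3617 : PowerSeries ℂ) * PowerSeries.C (16320 / 3617) = 16320 := by
    rw [show (3617 : PowerSeries ℂ) = PowerSeries.C 3617 from (map_ofNat _ _).symm, ← map_mul,
      mul_div_cancel₀ _ (by norm_num), map_ofNat]
  linear_combination sigmaSeries ℂ 15 * h

lemma constantCoeff_sigmaSeries (R : Type*) [CommRing R] (k : ℕ) :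
    PowerSeries.constantCoeff (sigmaSeries R k) = 0 := by
  simp [sigmaSeries, ← PowerSeries.coeff_zero_eq_constantCoeff_apply]

/-- The Serre derivative of `E₄` has weight 6 and constant term `-4/12`, which determines it as a
multiple of `E₆`. -/
theorem three_smul_euler_E4 :
    (3 : ℂ) • PowerSeries.euler ℂ (qExpansion 1 E₄) =
      qExpansion 1 E2 * qExpansion 1 E₄ - qExpansion 1 E₆ := by
  have h : serreDerivativeForm E₄ =
      (-(1 / 3) : ℂ) • (mcast (by norm_num) E₆ : ModularForm 𝒮ℒ (4 + 2)) := by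
    apply eq_of_constantCoeff_eq (by decide)
    rw [qExpansion_serreDerivativeForm, FunLike.coe_smul,
      ModularForm.qExpansion_smul one_pos one_mem_strictPeriods_SL, coe_mcast,
      qExpansion_E4_eq, qExpansion_E6_eq, qExpansion_E2_eq]
    simp [constantCoeff_sigmaSeries, PowerSeries.euler]
    norm_num
  have h' := congrArg (fun f : ModularForm 𝒮ℒ (4 + 2) ↦ (3 : ℂ) • qExpansion 1 f) h
  simp only [qExpansion_serreDerivativeForm, FunLike.coe_smul,
      ModularForm.qExpansion_smul one_pos one_mem_strictPeriods_SL, coe_mcast] at h'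
  push_cast at h'
  linear_combination (norm := module) h'

theorem two_smul_euler_E6 :
    (2 : ℂ) • PowerSeries.euler ℂ (qExpansion 1 E₆) =
      qExpansion 1 E2 * qExpansion 1 E₆ - qExpansion 1 E₄ ^ 2 := by
  have h : serreDerivativeForm E₆ =
      (-(1 / 2) : ℂ) • (mcast (by norm_num) (E₄.pow 2) : ModularForm 𝒮ℒ (6 + 2)) := by
    apply eq_of_constantCoeff_eq (by decide)
    rw [qExpansion_serreDerivativeForm, FunLike.coe_smul,
      ModularForm.qExpansion_smul one_pos one_mem_strictPeriods_SL, coe_mcast,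
      ModularForm.qExpansion_pow one_pos one_mem_strictPeriods_SL,
      qExpansion_E4_eq, qExpansion_E6_eq, qExpansion_E2_eq]
    simp [constantCoeff_sigmaSeries, PowerSeries.euler]
    norm_num
  have h' := congrArg (fun f : ModularForm 𝒮ℒ (6 + 2) ↦ (2 : ℂ) • qExpansion 1 f) h
  simp only [qExpansion_serreDerivativeForm, FunLike.coe_smul,
      ModularForm.qExpansion_smul one_pos one_mem_strictPeriods_SL, coe_mcast,
      ModularForm.qExpansion_pow one_pos one_mem_strictPeriods_SL] at h'
  push_cast at h'
  linear_combination (norm := module) h'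

theorem qExpansion_E4_mul_E6 :
    qExpansion 1 E₄ * qExpansion 1 E₆ = qExpansion 1 (E (k := 10) (by norm_num)) := by
  have h : E₄.mul E₆ = (mcast (by norm_num) (E (k := 10) (by norm_num)) :
      ModularForm 𝒮ℒ (4 + 6)) := by
    apply eq_of_constantCoeff_eq (by decide)
    rw [ModularForm.qExpansion_mul one_pos one_mem_strictPeriods_SL, coe_mcast,
      qExpansion_E4_eq, qExpansion_E6_eq, qExpansion_E10_eq]
    simp [constantCoeff_sigmaSeries]
  have h' := congrArg (fun f : ModularForm 𝒮ℒ (4 + 6) ↦ qExpansion 1 f) h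
  simpa only [ModularForm.qExpansion_mul one_pos one_mem_strictPeriods_SL, coe_mcast] using h'

lemma coeff_one_sigmaSeries (R : Type*) [CommRing R] (k : ℕ) :
    (sigmaSeries R k).coeff 1 = 1 := by
  simp [sigmaSeries]

/-- In weight 16 the Sturm bound is 1, so the coefficients of `1` and `q` decide; they fix the
weights 1617 and 2000. -/
theorem qExpansion_E16_eq_polynomial :
    1617 * qExpansion 1 E₄ ^ 4 + 2000 * (qExpansion 1 E₄ * qExpansion 1 E₆ ^ 2) =
      3617 * qExpansion 1 (E (k := 16) (by norm_num)) := by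
  let f : ModularForm 𝒮ℒ 16 := (1617 : ℂ) • (mcast (by norm_num) (E₄.pow 4) : ModularForm 𝒮ℒ 16) +
    (2000 : ℂ) • (mcast (by norm_num) (E₄.mul (E₆.pow 2)) : ModularForm 𝒮ℒ 16) -
    (3617 : ℂ) • (mcast (by norm_num) (E (k := 16) (by norm_num)) : ModularForm 𝒮ℒ 16)
  have hq : qExpansion 1 f = 1617 * qExpansion 1 E₄ ^ 4 +
      2000 * (qExpansion 1 E₄ * qExpansion 1 E₆ ^ 2) -
      3617 * qExpansion 1 (E (k := 16) (by norm_num)) := by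
    simp only [f, FunLike.coe_smul, FunLike.coe_add, FunLike.coe_sub]
    rw [← FunLike.coe_smul, ← FunLike.coe_smul, ← FunLike.coe_smul, ← FunLike.coe_add,
      ModularForm.qExpansion_sub one_pos one_mem_strictPeriods_SL, FunLike.coe_add,
      ModularForm.qExpansion_add one_pos one_mem_strictPeriods_SL]
    simp only [FunLike.coe_smul,
      ModularForm.qExpansion_smul one_pos one_mem_strictPeriods_SL, coe_mcast,
      ModularForm.qExpansion_mul one_pos one_mem_strictPeriods_SL,
      ModularForm.qExpansion_pow one_pos one_mem_strictPeriods_SL, PowerSeries.smul_eq_C_mul,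
      map_ofNat]
  have hf : f = 0 := by
    apply sturm_bound_levelOne
    refine lt_of_lt_of_le (b := ((2 : ℕ) : ℕ∞)) (by norm_cast) (PowerSeries.nat_le_order _ _ ?_)
    intro i hi
    rw [hq, qExpansion_E16_eq, qExpansion_E4_eq, qExpansion_E6_eq]
    simp only [← map_ofNat (PowerSeries.C (R := ℂ))]
    interval_cases i
    · simp [constantCoeff_sigmaSeries]
      norm_num
    · simp [PowerSeries.coeff_one_mul, PowerSeries.coeff_one_pow, coeff_one_sigmaSeries,
        constantCoeff_sigmaSeries, PowerSeries.coeff_one]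
      norm_num
  rw [hf, FunLike.coe_zero, qExpansion_zero] at hq
  exact (sub_eq_zero.mp hq.symm)

end

/-! ### Transfer of the Eisenstein identities to arbitrary coefficient rings. -/

section

open ModularForm EisensteinSeries PowerSeries UpperHalfPlane

lemma map_sigmaSeries {R S : Type*} [CommRing R] [CommRing S] (f : R →+* S) (k : ℕ) :
    PowerSeries.map f (sigmaSeries R k) = sigmaSeries S k := by
  ext n
  simp [sigmaSeries]

lemma map_euler {R S : Type*} [CommRing R] [CommRing S] (f : R →+* S) (g : R⟦X⟧) :
    PowerSeries.map f (euler R g) = euler S (PowerSeries.map f g) := by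
  ext n
  simp [coeff_euler]

lemma map_intCast_injective : Function.Injective (PowerSeries.map (Int.castRingHom ℂ)) :=
  PowerSeries.map_injective _ Int.cast_injective

/-- The `q`-expansion of the Eisenstein series of weight two. -/
noncomputable def eisP (R : Type*) [CommRing R] : R⟦X⟧ := 1 - 24 * sigmaSeries R 1

/-- The `q`-expansion of the Eisenstein series of weight four. -/
noncomputable def eisQ (R : Type*) [CommRing R] : R⟦X⟧ := 1 + 240 * sigmaSeries R 3

/-- The `q`-expansion of the Eisenstein series of weight six. -/
noncomputable def eisR (R : Type*) [CommRing R] : R⟦X⟧ := 1 - 504 * sigmaSeries R 5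

section transfer

variable {R S : Type*} [CommRing R] [CommRing S] (f : R →+* S)

lemma map_eisP : PowerSeries.map f (eisP R) = eisP S := by
  simp [map_ofNat, eisP, map_sigmaSeries]

lemma map_eisQ : PowerSeries.map f (eisQ R) = eisQ S := by
  simp [map_ofNat, eisQ, map_sigmaSeries]

lemma map_eisR : PowerSeries.map f (eisR R) = eisR S := by
  simp [map_ofNat, eisR, map_sigmaSeries]

variable (R)

/-- All series have integer coefficients, so the complex identity descends to `ℤ` and then maps to
any `R`. -/
theorem three_mul_euler_eisQ : 3 * euler R (eisQ R) = eisP R * eisQ R - eisR R := by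
  have h : 3 * euler ℤ (eisQ ℤ) = eisP ℤ * eisQ ℤ - eisR ℤ := by
    apply map_intCast_injective
    have h := three_smul_euler_E4
    rw [qExpansion_E2_eq, qExpansion_E4_eq, qExpansion_E6_eq, smul_eq_C_mul, map_ofNat] at h
    simpa [map_ofNat, map_euler, map_sigmaSeries, eisP, eisQ, eisR] using h
  simpa [map_ofNat, map_euler, map_eisP, map_eisQ, map_eisR] using
    congrArg (PowerSeries.map (Int.castRingHom R)) h

theorem two_mul_euler_eisR : 2 * euler R (eisR R) = eisP R * eisR R - eisQ R ^ 2 := by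
  have h : 2 * euler ℤ (eisR ℤ) = eisP ℤ * eisR ℤ - eisQ ℤ ^ 2 := by
    apply map_intCast_injective
    have h := two_smul_euler_E6
    rw [qExpansion_E2_eq, qExpansion_E4_eq, qExpansion_E6_eq, smul_eq_C_mul, map_ofNat] at h
    simpa [map_ofNat, map_euler, map_sigmaSeries, eisP, eisQ, eisR] using h
  simpa [map_ofNat, map_euler, map_eisP, map_eisQ, map_eisR] using
    congrArg (PowerSeries.map (Int.castRingHom R)) h

theorem eisQ_mul_eisR : eisQ R * eisR R = 1 - 264 * sigmaSeries R 9 := by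
  have h : eisQ ℤ * eisR ℤ = 1 - 264 * sigmaSeries ℤ 9 := by
    apply map_intCast_injective
    have h := qExpansion_E4_mul_E6
    rw [qExpansion_E4_eq, qExpansion_E6_eq, qExpansion_E10_eq] at h
    simpa [map_ofNat, map_sigmaSeries, eisP, eisQ, eisR] using h
  simpa [map_ofNat, map_sigmaSeries, map_eisQ, map_eisR] using
    congrArg (PowerSeries.map (Int.castRingHom R)) h

theorem eisQ_eisR_weight_sixteen :
    1617 * eisQ R ^ 4 + 2000 * (eisQ R * eisR R ^ 2) = 3617 + 16320 * sigmaSeries R 15 := by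
  have h : 1617 * eisQ ℤ ^ 4 + 2000 * (eisQ ℤ * eisR ℤ ^ 2) =
      3617 + 16320 * sigmaSeries ℤ 15 := by
    apply map_intCast_injective
    have h := qExpansion_E16_eq_polynomial
    rw [qExpansion_E16_eq, qExpansion_E4_eq, qExpansion_E6_eq] at h
    simpa [map_ofNat, map_sigmaSeries, eisP, eisQ, eisR] using h
  simpa [map_ofNat, map_sigmaSeries, map_eisQ, map_eisR] using
    congrArg (PowerSeries.map (Int.castRingHom R)) h

end transfer

/-! ### Euler's product and its logarithmic derivative. -/

section eulerProduct

variable (R : Type*) [CommRing R]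

/-- The partial product `∏_{k ≤ N} (1 - q^k)`. -/
noncomputable def qPoch (N : ℕ) : R⟦X⟧ := ∏ k ∈ Finset.range N, (1 - X ^ (k + 1))

/-- Euler's product `∏ (1 - q^k)`. -/
noncomputable def eulerProd : R⟦X⟧ := PowerSeries.mk fun n ↦ (qPoch R n).coeff n

lemma qPoch_succ (N : ℕ) : qPoch R (N + 1) = qPoch R N * (1 - X ^ (N + 1)) :=
  Finset.prod_range_succ _ _

lemma coeff_qPoch {d N : ℕ} (h : d ≤ N) : (qPoch R N).coeff d = (eulerProd R).coeff d := by
  induction N, h using Nat.le_induction with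
  | base => simp [eulerProd]
  | succ N hN ih =>
    rw [qPoch_succ, mul_sub, mul_one, map_sub, coeff_mul_X_pow', if_neg (by omega), sub_zero, ih]

lemma X_pow_dvd_qPoch_sub (N : ℕ) : (X : R⟦X⟧) ^ (N + 1) ∣ qPoch R N - eulerProd R := by
  rw [X_pow_dvd_iff]
  intro m hm
  rw [map_sub, coeff_qPoch R (by omega), sub_self]

variable {R} in
lemma eq_of_forall_X_pow_dvd_sub {f g : R⟦X⟧} (h : ∀ N, X ^ (N + 1) ∣ f - g) : f = g := by
  ext n
  have := X_pow_dvd_iff.mp (h n) n (by omega)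
  rwa [map_sub, sub_eq_zero] at this

/-- The power series `c q^m / (1 - q^m)`. -/
noncomputable def lambertTerm (m : ℕ) (c : R) : R⟦X⟧ :=
  PowerSeries.mk fun n ↦ if m ∣ n ∧ n ≠ 0 then c else 0

lemma one_sub_X_pow_mul_lambertTerm {m : ℕ} (hm : m ≠ 0) (c : R) :
    (1 - X ^ m) * lambertTerm R m c = C c * X ^ m := by
  ext n
  rw [sub_mul, one_mul, map_sub, coeff_X_pow_mul', coeff_C_mul, coeff_X_pow]
  simp only [lambertTerm, coeff_mk]
  by_cases h : m ≤ n
  · obtain ⟨d, rfl⟩ := Nat.exists_eq_add_of_le h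
    by_cases hd : d = 0
    · simp [hd, hm]
    · simp [hd]
  · have : ¬ (m ∣ n ∧ n ≠ 0) := fun h' ↦ h (Nat.le_of_dvd (Nat.pos_of_ne_zero h'.2) h'.1)
    rw [if_neg this, if_neg h, if_neg (by omega)]
    simp

lemma euler_qPoch (N : ℕ) :
    euler R (qPoch R N) =
      -(qPoch R N * ∑ k ∈ Finset.range N, lambertTerm R (k + 1) ((k + 1 : ℕ) : R)) := by
  induction N with
  | zero => simp [qPoch]
  | succ N ih =>
    have h : euler R (X ^ (N + 1)) = C ((N + 1 : ℕ) : R) * X ^ (N + 1) := by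
      ext n
      rw [coeff_euler, coeff_C_mul, coeff_X_pow]
      split_ifs with h <;> simp [h]
    rw [qPoch_succ, Derivation.leibniz, ih, Finset.sum_range_succ, map_sub, h,
      Derivation.map_one_eq_zero]
    simp only [smul_eq_mul]
    linear_combination qPoch R N * one_sub_X_pow_mul_lambertTerm R
      (Nat.add_one_ne_zero N) ((N + 1 : ℕ) : R)

lemma X_pow_dvd_sum_lambertTerm_sub (N : ℕ) :
    (X : R⟦X⟧) ^ (N + 1) ∣
      ∑ k ∈ Finset.range N, lambertTerm R (k + 1) ((k + 1 : ℕ) : R) - sigmaSeries R 1 := by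
  rw [X_pow_dvd_iff]
  intro m hm
  rw [map_sub, map_sum, sub_eq_zero]
  simp only [lambertTerm, sigmaSeries, coeff_mk, ArithmeticFunction.sigma_one_apply]
  rcases eq_or_ne m 0 with rfl | hm0
  · simp
  push_cast
  rw [← Finset.sum_filter]
  refine Finset.sum_bij (fun k _ ↦ k + 1) ?_ ?_ ?_ ?_
  · intro a ha
    simp at ha ⊢
    exact ha.2
  · simp
  · intro b hb
    rw [Nat.mem_divisors] at hb
    have := Nat.pos_of_dvd_of_pos hb.1 (by omega)
    have := Nat.le_of_dvd (by omega) hb.1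
    refine ⟨b - 1, ?_, by omega⟩
    simp [show b - 1 + 1 = b by omega, hb.1, hm0]
    omega
  · simp

/-- Logarithmic differentiation gives `-∑ k q^k / (1 - q^k)`; the partial products carry this out
modulo each power of `X`. -/
theorem euler_eulerProd : euler R (eulerProd R) = -(eulerProd R * sigmaSeries R 1) := by
  apply eq_of_forall_X_pow_dvd_sub
  intro N
  obtain ⟨u, hu⟩ := X_pow_dvd_qPoch_sub R N
  obtain ⟨v, hv⟩ := X_pow_dvd_sum_lambertTerm_sub R N
  have h := euler_qPoch R N
  have hd : X ^ (N + 1) ∣ euler R (qPoch R N) - euler R (eulerProd R) := by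
    rw [X_pow_dvd_iff]
    intro m hm
    rw [← map_sub, coeff_euler, map_sub, coeff_qPoch R (by omega), sub_self, mul_zero]
  obtain ⟨w, hw⟩ := hd
  refine ⟨-w - u * (sigmaSeries R 1) - v * qPoch R N, ?_⟩
  linear_combination -hw + h - hu * sigmaSeries R 1 - hv * qPoch R N

end eulerProduct

/-! ### Vanishing coefficients of `e^8` mod 11 and `e^14` mod 17. -/

section congruences

lemma natCast_char_eq_zero (p : ℕ) : (p : (ZMod p)⟦X⟧) = 0 := by
  rw [← map_natCast (C (R := ZMod p)), ZMod.natCast_self, map_zero]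

theorem coeff_eulerProd_pow_eight (n : ℕ) :
    (eulerProd (ZMod 11) ^ 8).coeff (11 * n + 7) = 0 := by
  have h11 : (11 : (ZMod 11)⟦X⟧) = 0 := mod_cast natCast_char_eq_zero 11
  have hE := euler_eulerProd (ZMod 11)
  have hR := two_mul_euler_eisR (ZMod 11)
  have hQR : eisQ (ZMod 11) * eisR (ZMod 11) = 1 := by
    linear_combination eisQ_mul_eisR (ZMod 11) - 24 * sigmaSeries (ZMod 11) 9 * h11
  have hP : eisP (ZMod 11) = 1 - 24 * sigmaSeries (ZMod 11) 1 := rfl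
  -- `R^3` has weight 18, and its Serre derivative is `-(3/2)(QR)^2`, a constant mod 11.
  set F := eulerProd (ZMod 11) ^ 8 * eisR (ZMod 11) ^ 3 with hF
  have key : 2 * euler (ZMod 11) F = 3 * F - 3 * eulerProd (ZMod 11) ^ 8 := by
    simp only [hF, Derivation.leibniz, Derivation.leibniz_pow, smul_eq_mul, nsmul_eq_mul]
    push_cast
    generalize eulerProd (ZMod 11) = e at *
    generalize sigmaSeries (ZMod 11) 1 = s at *
    generalize eisQ (ZMod 11) = Q at *
    generalize eisR (ZMod 11) = R at *
    rw [hE]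
    linear_combination 3 * e ^ 8 * R ^ 2 * hR + 3 * e ^ 8 * R ^ 3 * hP -
      8 * s * (e ^ 8 * R ^ 3) * h11 - 3 * e ^ 8 * (Q * R + 1) * hQR
  have h := congrArg (fun f ↦ f.coeff (11 * n + 7)) key
  have hC (c : ℕ) [c.AtLeastTwo] : (OfNat.ofNat c : (ZMod 11)⟦X⟧) = C (OfNat.ofNat c) :=
    (map_ofNat _ c).symm
  simp only [hC, map_sub, coeff_C_mul, coeff_euler] at h
  push_cast at h
  have h0 : (11 : ZMod 11) = 0 := by decide
  generalize coeff (11 * n + 7) F = a at h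
  generalize coeff (11 * n + 7) (eulerProd (ZMod 11) ^ 8) = b at *
  -- At this exponent `2(11n + 7) - 3 ≡ 0`, so only `3b = 0` remains; 4 inverts 3.
  linear_combination 4 * h - (b + 8 * n * a + 4 * a) * h0

theorem coeff_eulerProd_pow_fourteen (n : ℕ) :
    (eulerProd (ZMod 17) ^ 14).coeff (17 * n + 15) = 0 := by
  have h17 : (17 : (ZMod 17)⟦X⟧) = 0 := mod_cast natCast_char_eq_zero 17
  have hE := euler_eulerProd (ZMod 17)
  have hQ := three_mul_euler_eisQ (ZMod 17)
  have hR := two_mul_euler_eisR (ZMod 17)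
  have hA : 2 * eisQ (ZMod 17) ^ 4 + 11 * eisQ (ZMod 17) * eisR (ZMod 17) ^ 2 = 13 := by
    -- The integers are the quotients by 17 of 3617, 16320, 1617 and 2000.
    linear_combination eisQ_eisR_weight_sixteen (ZMod 17) + (212 + 960 * sigmaSeries (ZMod 17) 15 -
      95 * eisQ (ZMod 17) ^ 4 - 117 * eisQ (ZMod 17) * eisR (ZMod 17) ^ 2) * h17
  have hP : eisP (ZMod 17) = 1 - 24 * sigmaSeries (ZMod 17) 1 := rfl
  have hconst (c : ℕ) [c.AtLeastTwo] : euler (ZMod 17) (OfNat.ofNat c) = 0 :=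
    Derivation.map_natCast _ c
  generalize eulerProd (ZMod 17) = e at *
  generalize sigmaSeries (ZMod 17) 1 = s at *
  generalize eisQ (ZMod 17) = Q at *
  generalize eisR (ZMod 17) = R at *
  generalize eisP (ZMod 17) = P at *
  -- The weight 78 factor is chosen so that its Serre derivative, of weight 80, is `A^5` mod 17,
  -- where `A = 2Q^4 + 11QR^2 ≡ 13`.
  set F := e ^ 14 * (4 * (Q ^ 18 * R) + 15 * (Q ^ 15 * R ^ 3) + 8 * (Q ^ 12 * R ^ 5) +
    9 * (Q ^ 9 * R ^ 7) + 4 * (Q ^ 6 * R ^ 9) + 6 * (Q ^ 3 * R ^ 11) + 3 * R ^ 13) with hF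
  have key : 6 * euler (ZMod 17) F = 39 * F + 10 * e ^ 14 := by
    simp only [hF, map_add, hconst, Derivation.leibniz, Derivation.leibniz_pow, smul_eq_mul,
      nsmul_eq_mul, hE]
    push_cast
    generalize euler (ZMod 17) Q = Q' at *
    generalize euler (ZMod 17) R = R' at *
    linear_combination
      2 * e ^ 14 * (72 * Q ^ 17 * R + 225 * Q ^ 14 * R ^ 3 + 96 * Q ^ 11 * R ^ 5 +
        81 * Q ^ 8 * R ^ 7 + 24 * Q ^ 5 * R ^ 9 + 18 * Q ^ 2 * R ^ 11) * hQ +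
      3 * e ^ 14 * (4 * Q ^ 18 + 45 * Q ^ 15 * R ^ 2 + 40 * Q ^ 12 * R ^ 4 +
        63 * Q ^ 9 * R ^ 6 + 36 * Q ^ 6 * R ^ 8 + 66 * Q ^ 3 * R ^ 10 + 39 * R ^ 12) * hR +
      39 * F * hP +
      6 * e ^ 14 * ((2 * Q ^ 4 + 11 * Q * R ^ 2) ^ 4 + 13 * (2 * Q ^ 4 + 11 * Q * R ^ 2) ^ 3 +
        13 ^ 2 * (2 * Q ^ 4 + 11 * Q * R ^ 2) ^ 2 + 13 ^ 3 * (2 * Q ^ 4 + 11 * Q * R ^ 2) +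
        13 ^ 4) * hA +
      -- Here `131044 = (6 · 13^5 - 10) / 17` and `60 = (6 · 14 + 39 · 24) / 17`.
      (131044 * e ^ 14 - 60 * s * F - e ^ 14 * (9 * Q ^ 2 * R ^ 12 + 56856 * Q ^ 5 * R ^ 10 +
        51690 * Q ^ 8 * R ^ 8 + 18813 * Q ^ 11 * R ^ 6 + 3450 * Q ^ 14 * R ^ 4 +
        327 * Q ^ 17 * R ^ 2 + 12 * Q ^ 20)) * h17
  have h := congrArg (fun f ↦ f.coeff (17 * n + 15)) key
  have hC (c : ℕ) [c.AtLeastTwo] :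
      (OfNat.ofNat c : (ZMod 17)⟦X⟧) = C (OfNat.ofNat c) := (map_ofNat _ c).symm
  simp only [map_add, coeff_euler, hC 6, hC 39, hC 10, coeff_C_mul] at h
  push_cast at h
  have h0 : (17 : ZMod 17) = 0 := by decide
  generalize coeff (17 * n + 15) F = a at h
  generalize coeff (17 * n + 15) (e ^ 14) = b at *
  -- Now `6 · 15 - 39 = 51 ≡ 0`, which leaves `10b = 0`.
  linear_combination 5 * h + (3 * b - 30 * n * a - 15 * a) * h0

end congruences

end

section

open PowerSeries

/-! ### The triple product identity through a finite form. -/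

section tripleProduct

variable {A : Type*} [CommRing A] (y : A)

/-- The polynomials `ζ^n + ζ^(n-1) + ⋯ + ζ^(-n)`, written in terms of `y = 2 - ζ - ζ⁻¹`. -/
def chebU : ℕ → A
  | 0 => 1
  | 1 => 3 - y
  | n + 2 => (2 - y) * chebU (n + 1) - chebU n

variable (A) in
/-- The Gaussian binomial coefficient `[2N+1 choose N-n]`, through a recurrence in `N`. -/
noncomputable def centralGauss : ℕ → ℕ → A⟦X⟧
  | 0, 0 => 1
  | 0, _ + 1 => 0
  | N + 1, 0 => (1 + X ^ (2 * N + 2)) * centralGauss N 0 + X ^ (N + 1) * centralGauss N 0 +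
      X ^ (N + 2) * centralGauss N 1
  | N + 1, n + 1 => (1 + X ^ (2 * N + 2)) * centralGauss N (n + 1) +
      X ^ (N - n) * centralGauss N n + X ^ (N + n + 3) * centralGauss N (n + 2)

variable (A) in
-- This makes the truncated exponent `N - n` in the recurrence harmless.
lemma centralGauss_eq_zero {N n : ℕ} (h : N < n) : centralGauss A N n = 0 := by
  induction N generalizing n with
  | zero =>
    obtain ⟨n, rfl⟩ := Nat.exists_eq_succ_of_ne_zero (by omega : n ≠ 0)
    rfl
  | succ N ih =>
    obtain ⟨n, rfl⟩ := Nat.exists_eq_succ_of_ne_zero (by omega : n ≠ 0)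
    rw [Nat.succ_eq_add_one, centralGauss, ih (by omega), ih (by omega), ih (by omega)]
    ring

lemma qPoch_mul_centralGauss {N n : ℕ} (h : n ≤ N) :
    qPoch A (N - n) * qPoch A (N + n + 1) * centralGauss A N n = qPoch A (2 * N + 1) := by
  induction N generalizing n with
  | zero =>
    obtain rfl : n = 0 := by omega
    simp [centralGauss, qPoch]
  | succ N ih =>
    have hq : qPoch A (2 * (N + 1) + 1) =
        qPoch A (2 * N + 1) * (1 - X ^ (2 * N + 2)) * (1 - X ^ (2 * N + 3)) := by
      rw [show 2 * (N + 1) + 1 = 2 * N + 1 + 1 + 1 by ring, qPoch_succ, qPoch_succ]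
    rw [hq]
    rcases n with _ | n
    -- At the boundary, the symmetry of Gaussian binomials folds the index `-1` back to `0`.
    · have h0 := ih (Nat.zero_le N)
      rw [Nat.sub_zero, Nat.add_zero] at h0
      have h1 : qPoch A N * qPoch A (N + 1) * (1 - X ^ (N + 2)) * centralGauss A N 1 =
          (1 - X ^ N) * qPoch A (2 * N + 1) := by
        rcases N with _ | N
        · simp [centralGauss]
        · have h1 := ih (n := 1) (by omega)
          rw [show N + 1 - 1 = N by omega] at h1
          rw [← h1, qPoch_succ A (N + 1 + 1), qPoch_succ A N]
          ring
      rw [centralGauss, Nat.sub_zero, Nat.add_zero, qPoch_succ A (N + 1)]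
      rw [qPoch_succ A N] at h0 h1 ⊢
      linear_combination (1 - X ^ (N + 1)) * (1 - X ^ (N + 2)) *
        (1 + X ^ (2 * N + 2) + X ^ (N + 1)) * h0 + (1 - X ^ (N + 1)) * X ^ (N + 2) * h1
    · obtain ⟨d, rfl⟩ := Nat.exists_eq_add_of_le (by omega : n ≤ N)
      have h0 := ih (n := n) (by omega)
      have h1 : qPoch A d * qPoch A (n + d + n + 1) * (1 - X ^ (n + d + n + 2)) *
          centralGauss A (n + d) (n + 1) = (1 - X ^ d) * qPoch A (2 * (n + d) + 1) := by
        rcases d with _ | d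
        · simp [centralGauss_eq_zero]
        · rw [← ih (n := n + 1) (by omega), show n + (d + 1) - (n + 1) = d by omega,
            show n + (d + 1) + (n + 1) + 1 = n + (d + 1) + n + 1 + 1 by omega,
            qPoch_succ A d, qPoch_succ A (n + (d + 1) + n + 1)]
          ring
      -- The extra factor `X` turns `1 - X^(d-1)` into `X - X^d`, which avoids subtraction and
      -- covers small `d`.
      have h2 : X * (qPoch A d * qPoch A (n + d + n + 1) * (1 - X ^ (n + d + n + 2)) *
          (1 - X ^ (n + d + n + 3)) * centralGauss A (n + d) (n + 2)) =
          (1 - X ^ d) * (X - X ^ d) * qPoch A (2 * (n + d) + 1) := by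
        rcases d with _ | _ | d
        · simp [centralGauss_eq_zero]
        · simp [centralGauss_eq_zero]
        · rw [← ih (n := n + 2) (by omega), show n + (d + 1 + 1) - (n + 2) = d by omega,
            show n + (d + 1 + 1) + (n + 2) + 1 = n + (d + 1 + 1) + n + 1 + 1 + 1 by omega,
            qPoch_succ A (d + 1), qPoch_succ A d, qPoch_succ A (n + (d + 1 + 1) + n + 1 + 1),
            qPoch_succ A (n + (d + 1 + 1) + n + 1)]
          ring
      rw [show n + d - n = d by omega] at h0
      rw [centralGauss, show n + d + 1 - (n + 1) = d by omega, show n + d - n = d by omega,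
        show n + d + 1 + (n + 1) + 1 = n + d + n + 1 + 1 + 1 by omega,
        qPoch_succ A (n + d + n + 1 + 1), qPoch_succ A (n + d + n + 1)]
      linear_combination (1 + X ^ (2 * (n + d) + 2)) * (1 - X ^ (n + d + n + 3)) * h1 +
        X ^ d * (1 - X ^ (n + d + n + 2)) * (1 - X ^ (n + d + n + 3)) * h0 +
        X ^ (n + d + n + 2) * h2

variable (A) in
lemma constantCoeff_eulerProd : constantCoeff (eulerProd A) = 1 := by
  rw [← coeff_zero_eq_constantCoeff_apply, ← coeff_qPoch A (le_refl 0)]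
  simp [qPoch]

variable (A) in
lemma isUnit_eulerProd : IsUnit (eulerProd A) := by
  rw [isUnit_iff_constantCoeff, constantCoeff_eulerProd]
  exact isUnit_one

lemma X_pow_dvd_qPoch_sub_of_le {M N : ℕ} (h : M ≤ N) :
    (X : A⟦X⟧) ^ (M + 1) ∣ qPoch A N - eulerProd A :=
  (pow_dvd_pow X (by omega)).trans (X_pow_dvd_qPoch_sub A N)

/-- In the closed form each `qPoch` agrees with `e` to order at least `N - n`; cancel one factor
`e`. -/
lemma X_pow_dvd_eulerProd_mul_centralGauss_sub_one {N n : ℕ} (h : n ≤ N) :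
    (X : A⟦X⟧) ^ (N - n + 1) ∣ eulerProd A * centralGauss A N n - 1 := by
  obtain ⟨u, hu⟩ := X_pow_dvd_qPoch_sub_of_le (A := A) (le_refl (N - n))
  obtain ⟨v, hv⟩ := X_pow_dvd_qPoch_sub_of_le (A := A) (show N - n ≤ N + n + 1 by omega)
  obtain ⟨w, hw⟩ := X_pow_dvd_qPoch_sub_of_le (A := A) (show N - n ≤ 2 * N + 1 by omega)
  have hc := qPoch_mul_centralGauss (A := A) h
  rw [← (isUnit_eulerProd A).dvd_mul_left]
  refine ⟨w - u * qPoch A (N + n + 1) * centralGauss A N n -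
    eulerProd A * v * centralGauss A N n, ?_⟩
  linear_combination hc + hw - hu * qPoch A (N + n + 1) * centralGauss A N n -
    hv * eulerProd A * centralGauss A N n

lemma triangle_succ (n : ℕ) : (n + 1) * (n + 1 + 1) / 2 = n * (n + 1) / 2 + (n + 1) := by
  rw [show (n + 1) * (n + 1 + 1) = n * (n + 1) + (n + 1) * 2 by ring,
    Nat.add_mul_div_right _ _ two_pos]

lemma le_triangle (n : ℕ) : n ≤ n * (n + 1) / 2 := by
  induction n with
  | zero => simp
  | succ n ih => rw [triangle_succ]; omega

/-- Summation by parts for a sequence with a three-term recurrence. -/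
lemma sum_three_term {B : Type*} [CommRing B] {W : ℕ → B} {z : B} (h1 : W 1 = (z + 1) * W 0)
    (h2 : ∀ n, W (n + 2) = z * W (n + 1) - W n) (g : ℕ → B) (K : ℕ) :
    W 0 * (g 0 - g 1) - ∑ n ∈ Finset.range (K + 1), W (n + 1) * (g n + g (n + 2)) =
      -(z * ∑ n ∈ Finset.range (K + 1), g n * W n) -
        (g (K + 1) * W K + g (K + 2) * W (K + 1)) := by
  induction K with
  | zero => simp [h1]; ring
  | succ K ih =>
    rw [Finset.sum_range_succ _ (K + 1), Finset.sum_range_succ _ (K + 1)]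
    linear_combination ih - g (K + 1) * h2 K

/-- The finite form of the triple product identity. -/
theorem prod_eq_sum_centralGauss (N : ℕ) :
    ∏ k ∈ Finset.range N, ((1 - X ^ (k + 1)) ^ 2 + C y * X ^ (k + 1)) =
      ∑ n ∈ Finset.range (N + 1),
        (-1) ^ n * X ^ (n * (n + 1) / 2) * C (chebU y n) * centralGauss A N n := by
  induction N with
  | zero => simp [chebU, centralGauss]
  | succ N ih =>
    rw [Finset.prod_range_succ, ih]
    set W : ℕ → A⟦X⟧ := fun n ↦ C (chebU y n) with hW
    set g : ℕ → A⟦X⟧ := fun n ↦ (-1) ^ n * X ^ (n * (n + 1) / 2) * centralGauss A N n with hg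
    -- The new factor is `1 + X^(2N+2) - z X^(N+1)`; summation by parts turns multiplication by `z`
    -- into index shifts, matching the recurrence of `centralGauss`.
    have hsum := sum_three_term (W := W) (z := 2 - C y)
      (by simp [hW, chebU, map_ofNat]; ring) (by intro n; simp [hW, chebU, map_ofNat]) g N
    have hg1 : g (N + 1) = 0 := by simp [hg, centralGauss_eq_zero]
    have hg2 : g (N + 2) = 0 := by simp [hg, centralGauss_eq_zero]
    have hzero : centralGauss A (N + 1) 0 =
        (1 + X ^ (2 * N + 2)) * g 0 + X ^ (N + 1) * (g 0 - g 1) := by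
      rw [centralGauss]
      simp [hg]
      ring
    have hsucc (n : ℕ) (hn : n ∈ Finset.range (N + 1)) :
        (-1) ^ (n + 1) * X ^ ((n + 1) * (n + 1 + 1) / 2) * C (chebU y (n + 1)) *
          centralGauss A (N + 1) (n + 1) =
        (1 + X ^ (2 * N + 2)) * (g (n + 1) * W (n + 1)) -
          X ^ (N + 1) * (W (n + 1) * (g n + g (n + 2))) := by
      obtain ⟨d, rfl⟩ := Nat.exists_eq_add_of_le (Nat.lt_succ_iff.mp (Finset.mem_range.mp hn))
      rw [centralGauss, show n + d - n = d by omega]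
      simp only [hg, hW, triangle_succ]
      ring
    rw [Finset.sum_range_succ' _ (N + 1), Finset.sum_congr rfl hsucc, hzero,
      Finset.sum_sub_distrib, ← Finset.mul_sum, ← Finset.mul_sum]
    have hshift : ∑ n ∈ Finset.range (N + 1), g (n + 1) * W (n + 1) + g 0 * W 0 =
        ∑ n ∈ Finset.range (N + 1), g n * W n := by
      rw [← Finset.sum_range_succ' (fun n ↦ g n * W n), Finset.sum_range_succ, hg1]
      simp
    have hL : ∑ n ∈ Finset.range (N + 1),
        (-1) ^ n * X ^ (n * (n + 1) / 2) * C (chebU y n) * centralGauss A N n =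
        ∑ n ∈ Finset.range (N + 1), g n * W n :=
      Finset.sum_congr rfl fun n _ ↦ by simp only [hg, hW]; ring
    rw [hL]
    rw [hg1, hg2] at hsum
    have hW0 : C (chebU y 0) = W 0 := rfl
    rw [hW0]
    simp only [zero_mul, Nat.zero_div, pow_zero, one_mul, zero_add]
    linear_combination -X ^ (N + 1) * hsum - (1 + X ^ (2 * N + 2)) * hshift

/-- The theta series `∑ (-1)^n q^(n(n+1)/2) (ζ^n + ⋯ + ζ^(-n))`. -/
noncomputable def thetaSeries : A⟦X⟧ :=
  PowerSeries.mk fun d ↦ ∑ n ∈ Finset.range (d + 1),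
    if n * (n + 1) / 2 = d then (-1) ^ n * chebU y n else 0

lemma X_pow_dvd_sum_sub_thetaSeries (N : ℕ) :
    X ^ (N + 1) ∣ ∑ n ∈ Finset.range (N + 1),
      (-1) ^ n * X ^ (n * (n + 1) / 2) * C (chebU y n) - thetaSeries y := by
  rw [X_pow_dvd_iff]
  intro d hd
  rw [map_sub, sub_eq_zero, map_sum, thetaSeries, coeff_mk]
  have hterm (n : ℕ) : coeff d ((-1) ^ n * X ^ (n * (n + 1) / 2) * C (chebU y n)) =
      if n * (n + 1) / 2 = d then (-1) ^ n * chebU y n else 0 := by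
    rw [show (-1 : A⟦X⟧) ^ n * X ^ (n * (n + 1) / 2) * C (chebU y n) =
      C ((-1) ^ n * chebU y n) * X ^ (n * (n + 1) / 2) by simp; ring, coeff_C_mul, coeff_X_pow]
    simp [eq_comm]
  simp only [hterm]
  symm
  refine Finset.sum_subset (Finset.range_mono (by omega)) fun n _ hn ↦ if_neg fun h ↦ hn ?_
  have := le_triangle n
  simp
  omega

theorem X_pow_dvd_prod_sub_thetaSeries (N : ℕ) :
    X ^ (N + 1) ∣ eulerProd A * ∏ k ∈ Finset.range N, ((1 - X ^ (k + 1)) ^ 2 +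
      C y * X ^ (k + 1)) - thetaSeries y := by
  have h1 := X_pow_dvd_sum_sub_thetaSeries y N
  rw [prod_eq_sum_centralGauss]
  have h2 : X ^ (N + 1) ∣ eulerProd A * ∑ n ∈ Finset.range (N + 1),
        (-1) ^ n * X ^ (n * (n + 1) / 2) * C (chebU y n) * centralGauss A N n -
      ∑ n ∈ Finset.range (N + 1), (-1) ^ n * X ^ (n * (n + 1) / 2) * C (chebU y n) := by
    rw [Finset.mul_sum, ← Finset.sum_sub_distrib]
    refine Finset.dvd_sum fun n hn ↦ ?_
    have hn' : n ≤ N := Nat.lt_succ_iff.mp (Finset.mem_range.mp hn)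
    obtain ⟨u, hu⟩ := X_pow_dvd_eulerProd_mul_centralGauss_sub_one (A := A) hn'
    -- The factor `X^(n(n+1)/2)` makes up for the `n` orders of precision lost above.
    have hle : N + 1 ≤ n * (n + 1) / 2 + (N - n + 1) := by
      have := le_triangle n
      omega
    refine (pow_dvd_pow X hle).trans ⟨(-1) ^ n * C (chebU y n) * u, ?_⟩
    rw [pow_add]
    linear_combination (-1) ^ n * X ^ (n * (n + 1) / 2) * C (chebU y n) * hu
  simpa using dvd_add h2 h1

end tripleProduct

/-! ### The generating function of `MO` as a theta quotient. -/

section generatingFunction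

open scoped PowerSeries.WithPiTopology

variable {A : Type*} [CommRing A] (y : A)

/-- The generating function of partitions, weighted by `y` to the number of part sizes times the
product of the multiplicities. -/
noncomputable def moGenFun : A⟦X⟧ := Nat.Partition.genFun fun _ c ↦ (c : A) * y

lemma coeff_tsum_genFun_term [TopologicalSpace A] [DiscreteTopology A] {m : ℕ} (hm : m ≠ 0)
    (n : ℕ) :
    coeff n (∑' j : ℕ, (((j + 1 : ℕ) : A) * y) • (X : A⟦X⟧) ^ (m * (j + 1))) =
      if m ∣ n ∧ n ≠ 0 then ((n / m : ℕ) : A) * y else 0 := by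
  have hs := Nat.Partition.summable_genFun_term' (fun _ c ↦ (c : A) * y) hm
  rw [hs.map_tsum _ (WithPiTopology.continuous_coeff _ _)]
  simp only [map_smul, coeff_X_pow, smul_eq_mul, mul_ite, mul_one, mul_zero]
  split_ifs with h
  · obtain ⟨⟨c, rfl⟩, hc⟩ := h
    have hc0 : c ≠ 0 := by rintro rfl; simp at hc
    obtain ⟨c, rfl⟩ := Nat.exists_eq_succ_of_ne_zero hc0
    rw [tsum_eq_single c]
    · simp [Nat.mul_div_cancel_left _ (Nat.pos_of_ne_zero hm)]
    · intro b hb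
      rw [if_neg]
      simpa [hm] using fun h ↦ hb h.symm
  · convert! tsum_zero with j
    rw [if_neg]
    rintro rfl
    exact h ⟨dvd_mul_right _ _, by simp [hm]⟩

/-- This is `∑ j x^j = x / (1 - x)^2` at `x = q^(k+1)`, with one factor `1 - x` cleared at a time.
-/
lemma one_sub_X_pow_sq_mul_genFun_factor [TopologicalSpace A] [DiscreteTopology A] (k : ℕ) :
    (1 - X ^ (k + 1)) ^ 2 *
      (1 + ∑' j : ℕ, (((j + 1 : ℕ) : A) * y) • (X : A⟦X⟧) ^ ((k + 1) * (j + 1))) =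
      (1 - X ^ (k + 1)) ^ 2 + C y * X ^ (k + 1) := by
  have h : (1 - X ^ (k + 1)) *
      ∑' j : ℕ, (((j + 1 : ℕ) : A) * y) • (X : A⟦X⟧) ^ ((k + 1) * (j + 1)) =
      lambertTerm A (k + 1) y := by
    ext n
    rw [sub_mul, one_mul, map_sub, coeff_X_pow_mul', coeff_tsum_genFun_term y k.succ_ne_zero,
      lambertTerm, coeff_mk]
    by_cases hn : k + 1 ≤ n
    · obtain ⟨d, rfl⟩ := Nat.exists_eq_add_of_le hn
      rw [if_pos hn, Nat.add_sub_cancel_left, coeff_tsum_genFun_term y k.succ_ne_zero]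
      by_cases hd : k + 1 ∣ d
      · obtain ⟨c, rfl⟩ := hd
        rw [show k + 1 + (k + 1) * c = (k + 1) * (c + 1) by ring,
          Nat.mul_div_cancel_left _ k.succ_pos, Nat.mul_div_cancel_left _ k.succ_pos]
        rcases eq_or_ne c 0 with rfl | hc
        · simp
        · simp [hc]
          ring
      · simp [hd]
    · rw [if_neg hn, sub_zero]
      have : ¬ (k + 1 ∣ n ∧ n ≠ 0) :=
        fun h' ↦ hn (Nat.le_of_dvd (Nat.pos_of_ne_zero h'.2) h'.1)
      rw [if_neg this, if_neg this]
  linear_combination (1 - X ^ (k + 1)) * h +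
    one_sub_X_pow_mul_lambertTerm A (Nat.add_one_ne_zero k) y

/-- The triple product identity for the generating function of the `MO(a; n)`. -/
theorem moGenFun_mul_eulerProd_pow : moGenFun y * eulerProd A ^ 3 = thetaSeries y := by
  -- In the discrete topology, convergence means that each coefficient is eventually constant.
  let _ : TopologicalSpace A := ⊥
  have _ : DiscreteTopology A := ⟨rfl⟩
  apply eq_of_forall_X_pow_dvd_sub
  intro d
  set φ : ℕ → A⟦X⟧ := fun k ↦
    1 + ∑' j : ℕ, (((j + 1 : ℕ) : A) * y) • (X : A⟦X⟧) ^ ((k + 1) * (j + 1)) with hφ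
  have htend := (Nat.Partition.hasProd_genFun fun _ c ↦ (c : A) * y).tendsto_prod_nat
  rw [WithPiTopology.tendsto_iff_coeff_tendsto] at htend
  have hev : ∀ᶠ N in Filter.atTop, ∀ i ∈ Finset.range (d + 1),
      coeff i (∏ k ∈ Finset.range N, φ k) = coeff i (moGenFun y) := by
    rw [Filter.eventually_all_finset]
    intro i _
    have h := htend i
    rw [nhds_discrete, Filter.tendsto_pure] at h
    exact h
  obtain ⟨N, hN, hdN⟩ := (hev.and (Filter.eventually_ge_atTop d)).exists
  have hprod : qPoch A N ^ 2 * ∏ k ∈ Finset.range N, φ k =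
      ∏ k ∈ Finset.range N, ((1 - X ^ (k + 1)) ^ 2 + C y * X ^ (k + 1)) := by
    rw [qPoch, ← Finset.prod_pow, ← Finset.prod_mul_distrib]
    exact Finset.prod_congr rfl fun k _ ↦ one_sub_X_pow_sq_mul_genFun_factor y k
  have h1 : X ^ (d + 1) ∣ ∏ k ∈ Finset.range N, φ k - moGenFun y := by
    rw [X_pow_dvd_iff]
    intro i hi
    rw [map_sub, hN i (Finset.mem_range.mpr hi), sub_self]
  obtain ⟨u, hu⟩ := h1
  obtain ⟨v, hv⟩ := X_pow_dvd_qPoch_sub_of_le (A := A) hdN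
  obtain ⟨w, hw⟩ := (pow_dvd_pow X (Nat.add_le_add_right hdN 1)).trans
    (X_pow_dvd_prod_sub_thetaSeries y N)
  set Φ := ∏ k ∈ Finset.range N, φ k
  refine ⟨w - u * eulerProd A ^ 3 - v * (qPoch A N + eulerProd A) * eulerProd A * Φ, ?_⟩
  linear_combination hw + eulerProd A * hprod - eulerProd A ^ 3 * hu -
    (qPoch A N + eulerProd A) * eulerProd A * Φ * hv

theorem coeff_coeff_moGenFun (K : Type*) [CommRing K] (a n : ℕ) :
    (coeff n (moGenFun (Polynomial.X : Polynomial K))).coeff a = (MO a n : K) := by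
  rw [moGenFun, Nat.Partition.coeff_genFun, Polynomial.finsetSum_coeff, MO, Finset.sum_filter]
  push_cast
  refine Finset.sum_congr rfl fun p _ ↦ ?_
  rw [Finsupp.prod, Finset.prod_mul_distrib, Finset.prod_const, Multiset.toFinsupp_support]
  simp only [Multiset.toFinsupp_apply]
  rw [← Nat.cast_prod, ← Polynomial.C_eq_natCast, Polynomial.coeff_C_mul, Polynomial.coeff_X_pow]
  split_ifs with h1 h2 <;> simp_all

end generatingFunction
end

section

open PowerSeries

/-! ### Series supported on multiples of `p`. -/

section support

variable {K : Type*} [CommRing K] {p : ℕ}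

lemma coeff_mul_eq_zero_of_residue {P : ℕ → Prop} (hP : ∀ i j, p ∣ j → P (i + j) → P i)
    {f g : K⟦X⟧} (hf : ∀ n, P n → coeff n f = 0) (hg : ∀ n, ¬ p ∣ n → coeff n g = 0)
    {n : ℕ} (hn : P n) : coeff n (f * g) = 0 := by
  rw [coeff_mul]
  refine Finset.sum_eq_zero fun ⟨i, j⟩ hij ↦ ?_
  rw [Finset.HasAntidiagonal.mem_antidiagonal] at hij
  by_cases hj : p ∣ j
  · rw [hf i (hP i j hj (by rwa [hij])), zero_mul]
  · rw [hg j hj, mul_zero]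

/-- A factor in `X^p` with constant term 1 can be cancelled by strong induction, since it only links
exponents differing by multiples of `p`. -/
lemma coeff_eq_zero_of_mul_residue {P : ℕ → Prop} (hP : ∀ i j, p ∣ j → P (i + j) → P i)
    {f g : K⟦X⟧} (hfg : ∀ n, P n → coeff n (f * g) = 0) (hg : ∀ n, ¬ p ∣ n → coeff n g = 0)
    (hg0 : constantCoeff g = 1) {n : ℕ} (hn : P n) : coeff n f = 0 := by
  induction n using Nat.strong_induction_on with
  | _ n ih =>
    have h := hfg n hn
    rw [coeff_mul, Finset.sum_eq_single (n, 0)] at h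
    · simpa [hg0] using h
    · rintro ⟨i, j⟩ hij hne
      rw [Finset.HasAntidiagonal.mem_antidiagonal] at hij
      by_cases hj : p ∣ j
      · rw [ih i _ (hP i j hj (by rwa [hij])), zero_mul]
        rcases eq_or_ne j 0 with rfl | hj0
        · simp at hij
          simp [hij] at hne
        · simp at hij
          omega
      · rw [hg j hj, mul_zero]
    · simp

lemma not_dvd_of_dvd_add (i j : ℕ) (hj : p ∣ j) (h : ¬ p ∣ i + j) : ¬ p ∣ i :=
  fun hi ↦ h (dvd_add hi hj)

lemma coeff_one_sub_X_pow_pow_eq_zero (c k : ℕ) {n : ℕ} (hn : ¬ p ∣ n) :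
    coeff n ((1 - X ^ (p * c) : K⟦X⟧) ^ k) = 0 := by
  induction k generalizing n with
  | zero =>
    rw [pow_zero, coeff_one, if_neg]
    rintro rfl
    exact hn (dvd_zero p)
  | succ k ih =>
    rw [pow_succ]
    refine coeff_mul_eq_zero_of_residue (P := fun n ↦ ¬ p ∣ n) not_dvd_of_dvd_add (fun _ ↦ ih)
      (fun m hm ↦ ?_) hn
    rw [map_sub, coeff_one, coeff_X_pow, if_neg, if_neg, sub_zero]
    · rintro rfl
      exact hm (dvd_mul_right p c)
    · rintro rfl
      exact hm (dvd_zero p)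

end support

/-! ### Reduction mod `p` and the general criterion. -/

section prime

variable (p : ℕ) [hp : Fact p.Prime]

instance charP_powerSeries_zmod : CharP (ZMod p)⟦X⟧ p :=
  charP_of_injective_ringHom (PowerSeries.C_injective (R := ZMod p)) p

lemma one_sub_X_pow_pow_char (k : ℕ) :
    (1 - X ^ k : (ZMod p)⟦X⟧) ^ p = 1 - X ^ (p * k) := by
  rw [sub_pow_char, one_pow, ← pow_mul, mul_comm]

lemma coeff_prod_one_sub_X_pow_pow_char (s : Finset ℕ) {n : ℕ} (hn : ¬ p ∣ n) :
    coeff n (∏ k ∈ s, (1 - X ^ (k + 1) : (ZMod p)⟦X⟧) ^ p) = 0 := by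
  induction s using Finset.induction_on generalizing n with
  | empty =>
    rw [Finset.prod_empty, coeff_one, if_neg]
    rintro rfl
    exact hn (dvd_zero p)
  | insert a s ha ih =>
    rw [Finset.prod_insert ha, mul_comm]
    refine coeff_mul_eq_zero_of_residue (P := fun n ↦ ¬ p ∣ n) not_dvd_of_dvd_add (fun _ ↦ ih)
      (fun m hm ↦ ?_) hn
    rw [one_sub_X_pow_pow_char]
    simpa using coeff_one_sub_X_pow_pow_eq_zero (K := ZMod p) (a + 1) 1 hm

lemma coeff_eulerProd_pow_char {n : ℕ} (hn : ¬ p ∣ n) :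
    coeff n (eulerProd (ZMod p) ^ p) = 0 := by
  have hd : X ^ (n + 1) ∣ qPoch (ZMod p) n ^ p - eulerProd (ZMod p) ^ p :=
    (X_pow_dvd_qPoch_sub (ZMod p) n).trans (sub_dvd_pow_sub_pow _ _ _)
  have h := X_pow_dvd_iff.mp hd n (Nat.lt_succ_self n)
  rw [map_sub, sub_eq_zero] at h
  rw [← h, qPoch, ← Finset.prod_pow]
  exact coeff_prod_one_sub_X_pow_pow_char p _ hn

/-- The generating function of the coefficients of `y^a` in `chebU y n`. -/
noncomputable def chebCoeffSeries (K : Type*) [CommRing K] (a : ℕ) : K⟦X⟧ :=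
  PowerSeries.mk fun n ↦ (chebU (Polynomial.X : Polynomial K) n).coeff a

lemma coeff_one_sub_X_sq_mul {K : Type*} [CommRing K] (f : K⟦X⟧) (n : ℕ) :
    coeff (n + 2) ((1 - X) ^ 2 * f) = coeff (n + 2) f - 2 * coeff (n + 1) f + coeff n f := by
  rw [show (1 - X) ^ 2 * f = f - 2 * (X * f) + X * (X * f) by ring,
    show (2 : K⟦X⟧) = C 2 from (map_ofNat _ 2).symm]
  simp only [map_add, map_sub, coeff_C_mul, coeff_succ_X_mul]

lemma one_sub_X_sq_mul_chebCoeffSeries_zero (K : Type*) [CommRing K] :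
    (1 - X) ^ 2 * chebCoeffSeries K 0 = 1 + X := by
  ext n
  rcases n with _ | _ | n
  · simp [chebCoeffSeries, chebU]
  · simp [chebCoeffSeries, chebU, coeff_one_mul, coeff_one_pow, coeff_one, coeff_X]
    norm_num
  · rw [coeff_one_sub_X_sq_mul]
    simp [chebCoeffSeries, chebU, coeff_one, coeff_X, sub_mul, Polynomial.mul_coeff_zero]

/-- The recurrence of `chebU` reads `U_(n+2) - 2U_(n+1) + U_n = -y U_(n+1)`; compare powers of `y`.
-/
lemma one_sub_X_sq_mul_chebCoeffSeries_succ (K : Type*) [CommRing K] (a : ℕ) :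
    (1 - X) ^ 2 * chebCoeffSeries K (a + 1) = -X * chebCoeffSeries K a := by
  ext n
  rcases n with _ | _ | n
  · simp [chebCoeffSeries, chebU, Polynomial.coeff_one]
  · simp [chebCoeffSeries, chebU, coeff_one_mul, coeff_one_pow, coeff_one, coeff_X,
      Polynomial.coeff_one, Polynomial.coeff_X]
  · rw [coeff_one_sub_X_sq_mul, neg_mul, map_neg, coeff_succ_X_mul]
    simp [chebCoeffSeries, chebU, sub_mul]
    ring

theorem chebCoeffSeries_mul (K : Type*) [CommRing K] (a : ℕ) :
    chebCoeffSeries K a * (1 - X) ^ (2 * (a + 1)) = (-X) ^ a * (1 + X) := by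
  induction a with
  | zero =>
    rw [← one_sub_X_sq_mul_chebCoeffSeries_zero]
    ring
  | succ a ih =>
    rw [pow_succ (-X), mul_right_comm, ← ih]
    linear_combination (1 - X) ^ (2 * (a + 1)) * one_sub_X_sq_mul_chebCoeffSeries_succ K a

/-- For `a + 1 = p(m+1)` the denominator `(1 - X)^(2(a+1))` is a series in `X^p`, while the
numerator `±(X^a + X^(a+1))` lives in the classes `-1` and `0`. -/
lemma coeff_chebU_eq_zero (m : ℕ) {n : ℕ} (h0 : ¬ p ∣ n) (h1 : ¬ p ∣ n + 1) :
    (chebU (Polynomial.X : Polynomial (ZMod p)) n).coeff (p * m + (p - 1)) = 0 := by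
  have hp1 := hp.out.one_lt
  have h := chebCoeffSeries_mul (ZMod p) (p * m + (p - 1))
  have ha : 2 * (p * m + (p - 1) + 1) = p * (2 * (m + 1)) := by
    rw [add_assoc, Nat.sub_add_cancel hp1.le]
    ring
  rw [ha, pow_mul] at h
  have hfrob := one_sub_X_pow_pow_char p 1
  rw [pow_one] at hfrob
  rw [hfrob] at h
  suffices coeff n (chebCoeffSeries (ZMod p) (p * m + (p - 1))) = 0 by
    simpa [chebCoeffSeries] using this
  refine coeff_eq_zero_of_mul_residue (p := p) (P := fun n ↦ ¬ p ∣ n ∧ ¬ p ∣ n + 1)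
    (fun i j hj hij ↦ ⟨not_dvd_of_dvd_add i j hj hij.1, not_dvd_of_dvd_add (i + 1) j hj ?_⟩)
    (fun k hk ↦ ?_) (fun k hk ↦ coeff_one_sub_X_pow_pow_eq_zero 1 (2 * (m + 1)) hk)
    (by simp [hp.out.ne_zero]) ⟨h0, h1⟩
  · rw [add_right_comm]
    exact hij.2
  · rw [h, show (-X : (ZMod p)⟦X⟧) ^ (p * m + (p - 1)) * (1 + X) =
      C ((-1) ^ (p * m + (p - 1))) *
        (X ^ (p * m + (p - 1)) + X ^ (p * m + (p - 1) + 1)) by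
        rw [neg_pow]; simp; ring, coeff_C_mul, map_add, coeff_X_pow, coeff_X_pow, if_neg, if_neg]
    · simp
    · rintro rfl
      apply hk.1
      rw [add_assoc, Nat.sub_add_cancel hp1.le]
      exact ⟨m + 1, by ring⟩
    · rintro rfl
      apply hk.2
      rw [add_assoc, Nat.sub_add_cancel hp1.le]
      exact ⟨m + 1, by ring⟩

/-- The generating function `∑ MO(a; n) q^n`. -/
noncomputable def moSeries (K : Type*) [CommRing K] (a : ℕ) : K⟦X⟧ :=
  PowerSeries.mk fun n ↦ (MO a n : K)

lemma map_qPoch {R S : Type*} [CommRing R] [CommRing S] (f : R →+* S) (N : ℕ) :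
    PowerSeries.map f (qPoch R N) = qPoch S N := by
  simp [qPoch, map_prod]

lemma map_eulerProd {R S : Type*} [CommRing R] [CommRing S] (f : R →+* S) :
    PowerSeries.map f (eulerProd R) = eulerProd S := by
  ext n
  rw [coeff_map, eulerProd, eulerProd, coeff_mk, coeff_mk, ← map_qPoch f, coeff_map]

theorem coeff_moSeries_mul_eulerProd (K : Type*) [CommRing K] (a d : ℕ) :
    coeff d (moSeries K a * eulerProd K ^ 3) =
      (coeff d (thetaSeries (Polynomial.X : Polynomial K))).coeff a := by
  rw [← moGenFun_mul_eulerProd_pow, ← map_eulerProd Polynomial.C, ← map_pow, coeff_mul, coeff_mul,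
    Polynomial.finsetSum_coeff]
  refine Finset.sum_congr rfl fun x _ ↦ ?_
  rw [coeff_map, Polynomial.coeff_mul_C, coeff_coeff_moGenFun, moSeries, coeff_mk]

lemma coeff_moSeries_mul_eulerProd_eq_zero (hp2 : p ≠ 2) (m : ℕ) {d : ℕ} (hd : ¬ p ∣ d) :
    coeff d (moSeries (ZMod p) (p * m + (p - 1)) * eulerProd (ZMod p) ^ 3) = 0 := by
  rw [coeff_moSeries_mul_eulerProd, thetaSeries, coeff_mk, Polynomial.finsetSum_coeff]
  refine Finset.sum_eq_zero fun n _ ↦ ?_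
  split_ifs with h
  · have h2 : d * 2 = n * (n + 1) := by
      rw [← h]
      exact Nat.div_mul_cancel (Nat.even_mul_succ_self n).two_dvd
    have key : ¬ p ∣ n * (n + 1) := by
      rw [← h2]
      intro hdvd
      rcases hp.out.dvd_mul.mp hdvd with h' | h'
      · exact hd h'
      · exact hp2 ((Nat.prime_dvd_prime_iff_eq hp.out Nat.prime_two).mp h')
    rw [show (-1 : Polynomial (ZMod p)) ^ n = Polynomial.C ((-1) ^ n) by simp,
      Polynomial.coeff_C_mul, coeff_chebU_eq_zero p m (fun h' ↦ key (h'.mul_right _))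
        (fun h' ↦ key (h'.mul_left _)), mul_zero]
  · simp

/-- Write `M e^p = e^(p-3) (M e^3)`: both `e^p` and `M e^3` are series in `q^p`, so vanishing on a
class passes from `e^(p-3)` to `M`. -/
theorem MO_modEq_zero (hp2 : p ≠ 2) {r : ℕ}
    (hr : ∀ n, n % p = r → coeff n (eulerProd (ZMod p) ^ (p - 3)) = 0) (m : ℕ) {n : ℕ}
    (hn : n % p = r) : MO (p * m + (p - 1)) n ≡ 0 [MOD p] := by
  have hp3 : 3 ≤ p := by
    have := hp.out.two_le
    omega
  rw [← ZMod.natCast_eq_natCast_iff, Nat.cast_zero]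
  have hP (i j : ℕ) (hj : p ∣ j) (h : (i + j) % p = r) : i % p = r := by
    obtain ⟨c, rfl⟩ := hj
    simpa using h
  suffices coeff n (moSeries (ZMod p) (p * m + (p - 1))) = 0 by
    simpa [moSeries] using this
  refine coeff_eq_zero_of_mul_residue (p := p) (P := fun n ↦ n % p = r)
    (g := eulerProd (ZMod p) ^ p) hP (fun k hk ↦ ?_)
    (fun k ↦ coeff_eulerProd_pow_char p) (by simp [constantCoeff_eulerProd]) hn
  have hsplit : moSeries (ZMod p) (p * m + (p - 1)) * eulerProd (ZMod p) ^ p =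
      eulerProd (ZMod p) ^ (p - 3) *
        (moSeries (ZMod p) (p * m + (p - 1)) * eulerProd (ZMod p) ^ 3) := by
    rw [mul_left_comm, ← pow_add, Nat.sub_add_cancel hp3]
  rw [hsplit]
  exact coeff_mul_eq_zero_of_residue (P := fun n ↦ n % p = r) hP hr
    (fun _ ↦ coeff_moSeries_mul_eulerProd_eq_zero p hp2 m) hk

end prime

end

theorem mainTheorem5 :
    (∀ m n : ℕ, MO (3 * m + 2) (3 * n + 1) ≡ MO (3 * m + 2) (3 * n + 2) [MOD 3] ∧
      MO (3 * m + 2) (3 * n + 2) ≡ 0 [MOD 3]) ∧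
    (∀ m n : ℕ, MO (11 * m + 10) (11 * n + 7) ≡ 0 [MOD 11]) ∧
    (∀ m n : ℕ, MO (17 * m + 16) (17 * n + 15) ≡ 0 [MOD 17]) := by
  have : Fact (Nat.Prime 3) := ⟨by norm_num⟩
  have : Fact (Nat.Prime 11) := ⟨by norm_num⟩
  have : Fact (Nat.Prime 17) := ⟨by norm_num⟩
  -- For `p = 3` the power `e^0 = 1` vanishes on both nonzero classes.
  have h3 (r : ℕ) (hr : r ≠ 0) (n : ℕ) (hn : n % 3 = r) :
      PowerSeries.coeff n (eulerProd (ZMod 3) ^ (3 - 3)) = 0 := by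
    rw [Nat.sub_self, pow_zero, PowerSeries.coeff_one, if_neg (by omega)]
  refine ⟨fun m n ↦ ?_, fun m n ↦ ?_, fun m n ↦ ?_⟩
  · have h1 := MO_modEq_zero 3 (by norm_num) (h3 1 one_ne_zero) m (n := 3 * n + 1) (by omega)
    have h2 := MO_modEq_zero 3 (by norm_num) (h3 2 two_ne_zero) m (n := 3 * n + 2) (by omega)
    exact ⟨h1.trans h2.symm, h2⟩
  · refine MO_modEq_zero 11 (by norm_num) (r := 7) (fun k hk ↦ ?_) m (by omega)
    rw [← Nat.div_add_mod k 11, hk]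
    exact coeff_eulerProd_pow_eight _
  · refine MO_modEq_zero 17 (by norm_num) (r := 15) (fun k hk ↦ ?_) m (by omega)
    rw [← Nat.div_add_mod k 17, hk]
    exact coeff_eulerProd_pow_fourteen _
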